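/- Let $T$ be a topological group acting continuously on a non-empty compact metric space $X$. An action of $T$ on a compact metric space is called equicontinuous if the family of maps $x\mapsto tx$, $t\in T$, is equicontinuous, and minimal if all its orbits are dense. A factor map is a continuous, surjective, $T$-equivariant map, and its target is called a factor of its source. A maximal equicontinuous factor (MEF) of $(X,T)$ is an equicontinuous factor $(H,T)$ of $(X,T)$, with $H$ compact metric, such that every equicontinuous factor of $(X,T)$ is a factor of $(H,T)$. Suppose that $(X,T)$ is almost automorphic: its MEF $(H,T)$ is minimal and there is a factor map $\beta:X\to H$ whose set of injectivity points $$X_0=\{x\in X:\ \beta^{-1}(\{\beta(x)\})=\{x\}\}$$ is dense in $X$. Suppose moreover that $(X,T)$ is tame: its Ellis semigroup $E(X)$, the closure of $\{x\mapsto tx : t\in T\}$ in $X^X$ with the product topology, has cardinality at most $2^{\aleph_0}$. Theorem. For every such $\beta$, $(X,T)$ is a regular extension of its MEF: $(H,T)$ has exactly one $T$-invariant Borel probability measure $\mu$, and the set $\beta(X_0)$ has positive $\mu$-measure; in fact, $\beta(X_0)$ is a Borel set and $\mu(\beta(X_0))=1$. -/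

import Mathlib

open MeasureTheory
open scoped Cardinal

universe u v w

/-- `β : X → H` is a factor map of `T`-actions: continuous, onto and equivariant. -/
structure IsFactorMap (T : Type w) {X : Type u} {H : Type v}
    [TopologicalSpace X] [TopologicalSpace H] [SMul T X] [SMul T H] (β : X → H) : Prop where
  continuous : Continuous β
  surjective : Function.Surjective β
  map_smul : ∀ (t : T) (x : X), β (t • x) = t • β x

/-- `(X, T)` is equicontinuous: the family of maps `x ↦ t • x`, `t ∈ T`, is equicontinuous. -/
def IsEquicontinuousAction (T : Type w) (X : Type u) [UniformSpace X] [SMul T X] : Prop :=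
  Equicontinuous fun (t : T) (x : X) => t • x

/-- `(H, T)` is a maximal equicontinuous factor of `(X, T)`: it is an equicontinuous factor of
`(X, T)`, and every equicontinuous factor `(Z, T)` of `(X, T)` is a factor of `(H, T)`.
As a set, every factor of `X` is a quotient of `X`, so it is no restriction to let `Z` range over
the universe of `X`. -/
structure IsMaximalEquicontinuousFactor (T : Type w) (X : Type u) (H : Type v)
    [Group T] [TopologicalSpace T] [MetricSpace X] [MetricSpace H]
    [MulAction T X] [MulAction T H] : Prop where
  equicontinuous : IsEquicontinuousAction T H
  isFactor : ∃ β : X → H, IsFactorMap T β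
  maximal : ∀ (Z : Type u) [MetricSpace Z] [CompactSpace Z] [MulAction T Z] [ContinuousSMul T Z],
    IsEquicontinuousAction T Z → (∃ γ : X → Z, IsFactorMap T γ) → ∃ δ : H → Z, IsFactorMap T δ

/-- The set of injectivity points of `β`: the points `x` with `β ⁻¹ {β x} = {x}`. -/
def injectivityPoints {X : Type u} {H : Type v} (β : X → H) : Set X :=
  {x | β ⁻¹' {β x} = {x}}

/-- `β` is almost one-to-one: it is continuous and its injectivity points are dense. -/
def IsAlmostOneToOne {X : Type u} {H : Type v} [TopologicalSpace X] [TopologicalSpace H]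
    (β : X → H) : Prop :=
  Continuous β ∧ Dense (injectivityPoints β)

/-- `(X, T)` is almost automorphic, with maximal equicontinuous factor `(H, T)` and factor map `β`:
the maximal equicontinuous factor is minimal and `β` is an almost one-to-one factor map onto it. -/
structure IsAlmostAutomorphic (T : Type w) {X : Type u} {H : Type v}
    [Group T] [TopologicalSpace T] [MetricSpace X] [MetricSpace H]
    [MulAction T X] [MulAction T H] (β : X → H) : Prop where
  isMEF : IsMaximalEquicontinuousFactor T X H
  isMinimal : MulAction.IsMinimal T H
  isFactorMap : IsFactorMap T β
  isAlmostOneToOne : IsAlmostOneToOne β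

/-- The (underlying set of the) Ellis semigroup `E(X)`: the closure of the set of the maps
`x ↦ t • x`, `t ∈ T`, in `X → X` with the product topology. -/
def ellisSemigroup (T : Type w) (X : Type u) [TopologicalSpace X] [SMul T X] : Set (X → X) :=
  closure (Set.range fun (t : T) (x : X) => t • x)

/-- `(X, T)` is tame: its Ellis semigroup has at most the cardinality of the continuum. -/
def IsTame (T : Type w) (X : Type u) [TopologicalSpace X] [SMul T X] : Prop :=
  #(ellisSemigroup T X) ≤ 𝔠

/-- `μ` is a `T`-invariant Borel probability measure on `H`. -/
structure IsInvariantProbability (T : Type w) {H : Type v} [SMul T H] [MeasurableSpace H]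
    (μ : Measure H) : Prop where
  isProbabilityMeasure : IsProbabilityMeasure μ
  smulInvariant : SMulInvariantMeasure T H μ

/-- `μ` is the one and only `T`-invariant Borel probability measure on `H`. -/
def IsUniqueInvariantProbability (T : Type w) {H : Type v} [SMul T H] [MeasurableSpace H]
    (μ : Measure H) : Prop :=
  IsInvariantProbability T μ ∧ ∀ ν : Measure H, IsInvariantProbability T ν → ν = μ

/-- The extension `β : X → H` is regular: `(H, T)` is uniquely ergodic and the image of the set of
injectivity points of `β` has positive measure for the unique invariant probability measure. -/
def IsRegularExtension (T : Type w) {X : Type u} {H : Type v} [SMul T H] [MeasurableSpace H]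
    (β : X → H) : Prop :=
  ∃ μ : Measure H, IsUniqueInvariantProbability T μ ∧ 0 < μ (β '' injectivityPoints β)

/-! Equicontinuity turns the units of `ellisSemigroup T H` into a compact group G, transitive on H
because T is minimal there. The image μ of Haar measure under an orbit map is then the only
invariant probability. The complement of the image of the injectivity points is a countable union of
closed sets K = β(cl U) ∩ β(cl V) with cl U, cl V disjoint, so each such K must be shown null.
Density of the injectivity points puts K in the closure of both open sets {h | β⁻¹{h} ⊆ U} and {h |
β⁻¹{h} ⊆ V}. If μ K > 0, `exists_independence_sequence` builds t₀, t₁, ... in T realizing all finite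
patterns of visits to these two sets; by compactness all infinite patterns for cl U, cl V occur in
X. Limits of (tₙ) along distinct ultrafilters on ℕ are then distinct elements of the Ellis semigroup
of X, giving more than 𝔠 of them (`not_isTame_of_independent`). -/

open Filter Topology

/-! ### The Ellis semigroup as a monoid. -/

section EllisMonoid

variable {T : Type w} {X : Type u} [Group T] [TopologicalSpace X] [MulAction T X]

theorem smul_mem_ellisSemigroup (t : T) : (fun x : X => t • x) ∈ ellisSemigroup T X :=
  subset_closure ⟨t, rfl⟩

theorem id_mem_ellisSemigroup : (id : X → X) ∈ ellisSemigroup T X := by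
  convert smul_mem_ellisSemigroup (X := X) (1 : T) using 1
  exact funext fun x => (one_smul T x).symm

/-- Composition is continuous in the left factor always, but in the right factor only when the left
one is continuous; hence the closure is taken in two stages, with elements of T on the left first.
-/
theorem comp_mem_ellisSemigroup [ContinuousConstSMul T X] {f g : X → X}
    (hf : f ∈ ellisSemigroup T X) (hg : g ∈ ellisSemigroup T X) :
    f ∘ g ∈ ellisSemigroup T X := by
  have smul_comp : ∀ t : T, (fun x => t • g x) ∈ ellisSemigroup T X := by
    intro t
    have hc : Continuous fun k : X → X => fun x => t • k x :=
      continuous_pi fun x => (continuous_apply x).const_smul t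
    refine map_mem_closure (f := fun k : X → X => fun x => t • k x) hc hg ?_
    rintro _ ⟨s, rfl⟩
    exact ⟨t * s, funext fun x => mul_smul t s x⟩
  have hc : Continuous fun k : X → X => k ∘ g :=
    continuous_pi fun x => continuous_apply (g x)
  have h := map_mem_closure (t := ellisSemigroup T X) hc hf (by
    rintro _ ⟨t, rfl⟩
    exact smul_comp t)
  rwa [ellisSemigroup, closure_closure] at h

instance ellisSemigroup.instMonoid [ContinuousConstSMul T X] : Monoid (ellisSemigroup T X) where
  mul f g := ⟨f.1 ∘ g.1, comp_mem_ellisSemigroup f.2 g.2⟩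
  one := ⟨id, id_mem_ellisSemigroup⟩
  mul_assoc _ _ _ := rfl
  one_mul _ := rfl
  mul_one _ := rfl

instance ellisSemigroup.instMulAction [ContinuousConstSMul T X] :
    MulAction (ellisSemigroup T X) X where
  smul f x := f.1 x
  one_smul _ := rfl
  mul_smul _ _ _ := rfl

/-- The homomorphism from the acting group to its Ellis semigroup. -/
def toEllisSemigroup (T : Type w) (X : Type u) [Group T] [TopologicalSpace X] [MulAction T X]
    [ContinuousConstSMul T X] : T →* ellisSemigroup T X where
  toFun t := ⟨fun x => t • x, smul_mem_ellisSemigroup t⟩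
  map_one' := Subtype.ext (funext fun x => one_smul T x)
  map_mul' s t := Subtype.ext (funext fun x => mul_smul s t x)

instance ellisSemigroup.instCompactSpace [CompactSpace X] : CompactSpace (ellisSemigroup T X) :=
  isCompact_iff_compactSpace.1 isClosed_closure.isCompact

end EllisMonoid

/-! ### The compact group of units in the equicontinuous case. -/

section Equicontinuous

variable {T : Type w} {H : Type v} [Group T] [UniformSpace H] [MulAction T H]

theorem IsEquicontinuousAction.equicontinuous_ellisSemigroup (hT : IsEquicontinuousAction T H) :
    Equicontinuous fun (f : ellisSemigroup T H) (x : H) => f.1 x :=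
  Set.Equicontinuous.closure (equicontinuous_iff_range.1 hT)

variable [ContinuousConstSMul T H]

theorem IsEquicontinuousAction.continuousSMul_ellisSemigroup (hT : IsEquicontinuousAction T H) :
    ContinuousSMul (ellisSemigroup T H) H := by
  refine ⟨continuous_iff_continuousAt.2 fun p => ?_⟩
  obtain ⟨f, x⟩ := p
  refine Uniform.tendsto_nhds_right.2 ?_
  refine tendsto_def.2 fun s hs => ?_
  obtain ⟨r, hr, hrs⟩ := comp_mem_uniformity_sets hs
  have h1 : ∀ᶠ y in 𝓝 x, ∀ k : ellisSemigroup T H, (k.1 x, k.1 y) ∈ r :=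
    hT.equicontinuous_ellisSemigroup x r hr
  have h2 : ∀ᶠ k in 𝓝 f, (f.1 x, k.1 x) ∈ r := by
    have hc : Continuous fun k : ellisSemigroup T H => k.1 x :=
      (continuous_apply x).comp continuous_subtype_val
    exact Uniform.tendsto_nhds_right.1 (hc.tendsto f) hr
  rw [nhds_prod_eq]
  filter_upwards [h2.prod_mk h1] with q hq
  exact hrs ⟨_, hq.1, hq.2 q.1⟩

theorem IsEquicontinuousAction.continuousMul_ellisSemigroup (hT : IsEquicontinuousAction T H) :
    ContinuousMul (ellisSemigroup T H) := by
  have := hT.continuousSMul_ellisSemigroup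
  refine ⟨Continuous.subtype_mk (continuous_pi fun x => ?_) _⟩
  have h : Continuous fun p : ellisSemigroup T H × ellisSemigroup T H => p.1 • (p.2 • x) :=
    continuous_fst.smul (continuous_snd.smul continuous_const)
  exact h

/-- The pairs (u, u⁻¹) form a closed subset of the compact product of the monoid with its opposite.
-/
theorem IsEquicontinuousAction.compactSpace_units_ellisSemigroup [CompactSpace H] [T2Space H]
    (hT : IsEquicontinuousAction T H) : CompactSpace (ellisSemigroup T H)ˣ := by
  have := hT.continuousMul_ellisSemigroup
  exact Units.isClosedEmbedding_embedProduct.compactSpace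

/-- The units of the Ellis semigroup of a minimal equicontinuous action act transitively. -/
theorem IsEquicontinuousAction.exists_units_smul_eq [CompactSpace H] [T2Space H]
    (hT : IsEquicontinuousAction T H) [MulAction.IsMinimal T H] (x y : H) :
    ∃ g : (ellisSemigroup T H)ˣ, g • x = y := by
  have := hT.continuousSMul_ellisSemigroup
  have := hT.compactSpace_units_ellisSemigroup
  have hc : Continuous fun g : (ellisSemigroup T H)ˣ => g • x :=
    Units.continuous_val.smul continuous_const
  have hcl : IsClosed (Set.range fun g : (ellisSemigroup T H)ˣ => g • x) :=
    (isCompact_range hc).isClosed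
  have hsub : MulAction.orbit T x ⊆ Set.range fun g : (ellisSemigroup T H)ˣ => g • x := by
    rintro _ ⟨t, rfl⟩
    exact ⟨(toEllisSemigroup T H).toHomUnits t, rfl⟩
  have hy := (MulAction.dense_orbit T x).mono hsub y
  rwa [hcl.closure_eq] at hy

end Equicontinuous

/-! ### Unique ergodicity via Haar measure. -/

section UniqueInvariantMeasure

variable {T : Type w} {H : Type v} {G : Type*} [Group T] [MulAction T H] [Group G]
  [MetricSpace H] [MeasurableSpace H] [BorelSpace H] [MulAction G H]

/-- A `T`-invariant measure is invariant under pointwise limits of elements of `T`. -/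
theorem integral_smul_eq_of_mem_closure [CompactSpace H]
    (hG : ∀ g : G, (fun x : H => g • x) ∈ ellisSemigroup T H)
    (hT : IsEquicontinuousAction T H) [ContinuousConstSMul T H]
    {ν : Measure H} (hν : IsInvariantProbability T ν) (f : C(H, ℝ)) (g : G) :
    ∫ x, f (g • x) ∂ν = ∫ x, f x ∂ν := by
  have := hν.isProbabilityMeasure
  have := hν.smulInvariant
  have := hT.continuousSMul_ellisSemigroup
  have hc : Continuous fun e : ellisSemigroup T H => ∫ x, f (e • x) ∂ν := by
    have hu : Continuous (Function.uncurry fun (e : ellisSemigroup T H) (x : H) => f (e • x)) :=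
      f.continuous.comp (continuous_fst.smul continuous_snd)
    rw [← continuousOn_univ]
    exact continuousOn_integral_of_compact_support (k := Set.univ) isCompact_univ
      hu.continuousOn fun p x _ hx => absurd (Set.mem_univ x) hx
  have hd : DenseRange (toEllisSemigroup T H) := by
    intro e
    rw [closure_subtype, ← Set.range_comp]
    exact e.2
  have heq := hd.equalizer hc (continuous_const (y := ∫ x, f x ∂ν)) <|
    funext fun t => integral_smul_eq_self (μ := ν) f (g := t)
  exact congrFun heq ⟨_, hG g⟩

variable [TopologicalSpace G] [IsTopologicalGroup G] [CompactSpace G] [MeasurableSpace G]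
  [BorelSpace G]

theorem isProbabilityMeasure_haarMeasure_top :
    IsProbabilityMeasure (Measure.haarMeasure (⊤ : TopologicalSpace.PositiveCompacts G)) :=
  ⟨by simpa using Measure.haarMeasure_self (K₀ := (⊤ : TopologicalSpace.PositiveCompacts G))⟩

variable [ContinuousSMul G H]

/-- The image of Haar measure under an orbit map is `T`-invariant. -/
theorem isInvariantProbability_map_haarMeasure
    (hTG : ∀ t : T, ∃ g : G, ∀ x : H, g • x = t • x) (x : H) :
    IsInvariantProbability T ((Measure.haarMeasure
      (⊤ : TopologicalSpace.PositiveCompacts G)).map fun g : G => g • x) := by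
  have := isProbabilityMeasure_haarMeasure_top (G := G)
  have hm : Measurable fun g : G => g • x := (continuous_id.smul continuous_const).measurable
  refine ⟨Measure.isProbabilityMeasure_map hm.aemeasurable, ⟨fun t s hs => ?_⟩⟩
  obtain ⟨g, hg⟩ := hTG t
  have hs' : MeasurableSet ((fun y : H => t • y) ⁻¹' s) := by
    simp_rw [← hg]
    exact (continuous_const_smul g).measurable hs
  rw [Measure.map_apply hm hs', Measure.map_apply hm hs, ← Set.preimage_comp]
  rw [← measure_preimage_mul _ g ((fun g : G => g • x) ⁻¹' s)]
  congr 1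
  ext k
  simp [mul_smul, hg]

variable [CompactSpace H]

/-- Integrate f(g⁻¹x) over G × H in both orders. Invariance of ν makes the inner integral over H
constant; transitivity and left invariance of Haar measure make the one over G constant. The right
side does not involve ν, whence uniqueness. -/
theorem integral_eq_integral_inv_smul
    (hG : ∀ g : G, (fun x : H => g • x) ∈ ellisSemigroup T H)
    (hT : IsEquicontinuousAction T H) [ContinuousConstSMul T H]
    (htrans : ∀ x y : H, ∃ g : G, g • x = y)
    {ν : Measure H} (hν : IsInvariantProbability T ν) (f : C(H, ℝ)) (x₀ : H) :
    ∫ x, f x ∂ν = ∫ g : G, f (g⁻¹ • x₀) ∂(Measure.haarMeasure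
      (⊤ : TopologicalSpace.PositiveCompacts G)) := by
  have := isProbabilityMeasure_haarMeasure_top (G := G)
  have := hν.isProbabilityMeasure
  set m := Measure.haarMeasure (⊤ : TopologicalSpace.PositiveCompacts G)
  have hu : Continuous (Function.uncurry fun (g : G) (x : H) => f (g⁻¹ • x)) :=
    f.continuous.comp (continuous_fst.inv.smul continuous_snd)
  have hswap : ∫ g, ∫ x, f (g⁻¹ • x) ∂ν ∂m = ∫ x, ∫ g, f (g⁻¹ • x) ∂m ∂ν :=
    integral_integral_swap_of_hasCompactSupport hu (HasCompactSupport.of_compactSpace _)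
  have hleft : ∀ x, ∫ g, f (g⁻¹ • x) ∂m = ∫ g, f (g⁻¹ • x₀) ∂m := by
    intro x
    obtain ⟨k, rfl⟩ := htrans x₀ x
    rw [← integral_mul_left_eq_self _ k]
    simp [mul_smul]
  simp_rw [integral_smul_eq_of_mem_closure hG hT hν f, hleft] at hswap
  simpa using hswap

/-- A compact group acting transitively by limits of `T` forces unique ergodicity. -/
theorem isUniqueInvariantProbability_map_haarMeasure
    (hG : ∀ g : G, (fun x : H => g • x) ∈ ellisSemigroup T H)
    (hTG : ∀ t : T, ∃ g : G, ∀ x : H, g • x = t • x)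
    (hT : IsEquicontinuousAction T H) [ContinuousConstSMul T H]
    (htrans : ∀ x y : H, ∃ g : G, g • x = y) (x : H) :
    IsUniqueInvariantProbability T ((Measure.haarMeasure
      (⊤ : TopologicalSpace.PositiveCompacts G)).map fun g : G => g • x) := by
  have hμ := isInvariantProbability_map_haarMeasure hTG x
  refine ⟨hμ, fun ν hν => ?_⟩
  have := hν.isProbabilityMeasure
  have := hμ.isProbabilityMeasure
  refine ext_of_forall_integral_eq_of_IsFiniteMeasure fun f => ?_
  exact (integral_eq_integral_inv_smul hG hT htrans hν f.toContinuousMap x).trans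
    (integral_eq_integral_inv_smul hG hT htrans hμ f.toContinuousMap x).symm

end UniqueInvariantMeasure

/-! ### There are more than 𝔠 ultrafilters on ℕ. -/

section Ultrafilter

/-- Hausdorff's independent family of subsets of a countable set, indexed by the sets of
natural numbers. -/
def independentFamily (A : Set ℕ) : Set (ℕ × Finset (Finset ℕ)) :=
  open Classical in {p | (Finset.range p.1).filter (· ∈ A) ∈ p.2}

/-- For large n the members of F have distinct traces on {0, ..., n-1}; the second coordinate
collects the traces of those in S. -/
theorem exists_forall_mem_independentFamily_iff (F : Finset (Set ℕ)) (S : Set (Set ℕ)) :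
    ∃ p, ∀ A ∈ F, p ∈ independentFamily A ↔ A ∈ S := by
  classical
  have hev : ∀ᶠ n in atTop, ∀ A ∈ F, ∀ B ∈ F,
      (Finset.range n).filter (· ∈ A) = (Finset.range n).filter (· ∈ B) → A = B := by
    rw [eventually_all_finset]
    intro A _
    rw [eventually_all_finset]
    intro B _
    by_cases hAB : A = B
    · simp [hAB]
    obtain ⟨k, hk⟩ : ∃ k, ¬ (k ∈ A ↔ k ∈ B) := by
      by_contra! h
      exact hAB (Set.ext h)
    filter_upwards [eventually_gt_atTop k] with n hn h
    have := Finset.ext_iff.1 h k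
    simp only [Finset.mem_filter, Finset.mem_range, hn, true_and] at this
    exact absurd this hk
  obtain ⟨n, hn⟩ := hev.exists
  refine ⟨(n, (F.filter (· ∈ S)).image fun A => (Finset.range n).filter (· ∈ A)), fun A hA => ?_⟩
  simp only [independentFamily, Set.mem_ofPred_eq, Finset.mem_image, Finset.mem_filter]
  constructor
  · rintro ⟨B, ⟨hB, hBS⟩, h⟩
    exact hn B hB A hA h ▸ hBS
  · intro h
    exact ⟨A, ⟨hA, h⟩, rfl⟩

theorem exists_ultrafilter_independentFamily_mem_iff (S : Set (Set ℕ)) :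
    ∃ p : Ultrafilter (ℕ × Finset (Finset ℕ)), ∀ A, independentFamily A ∈ p ↔ A ∈ S := by
  classical
  let C : Set ℕ → Set (ℕ × Finset (Finset ℕ)) := fun A => {p | p ∈ independentFamily A ↔ A ∈ S}
  have hne : (generate (Set.range C)).NeBot := by
    rw [generate_neBot_iff]
    intro t ht hfin
    obtain ⟨F, hF⟩ := Set.Finite.exists_finset_coe hfin
    choose! i hi using fun s (hs : s ∈ t) => ht hs
    obtain ⟨p, hp⟩ := exists_forall_mem_independentFamily_iff (F.image i) S
    refine ⟨p, fun s hs => ?_⟩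
    rw [← hi s hs]
    refine hp _ (Finset.mem_image_of_mem i ?_)
    rwa [← Finset.mem_coe, hF]
  refine ⟨Ultrafilter.of (generate (Set.range C)), fun A => ?_⟩
  have hC : C A ∈ Ultrafilter.of (generate (Set.range C)) :=
    Ultrafilter.of_le _ (mem_generate_of_mem ⟨A, rfl⟩)
  by_cases hA : A ∈ S
  · exact iff_of_true (mem_of_superset hC fun p hp => hp.2 hA) hA
  · refine iff_of_false (fun h => ?_) hA
    obtain ⟨p, hp, hp'⟩ := Ultrafilter.nonempty_of_mem (inter_mem hC h)
    exact hA (hp.1 hp')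

theorem continuum_lt_mk_ultrafilter_nat : 𝔠 < #(Ultrafilter ℕ) := by
  choose p hp using exists_ultrafilter_independentFamily_mem_iff
  obtain ⟨e⟩ : Nonempty (ℕ × Finset (Finset ℕ) ≃ ℕ) := nonempty_equiv_of_countable
  have hinj : Function.Injective fun S : Set (Set ℕ) => (p S).map e := by
    intro S S' h
    ext A
    rw [← hp S A, ← hp S' A]
    have h' := Ultrafilter.ext_iff.1 h (e '' independentFamily A)
    simpa [Ultrafilter.mem_map, Set.preimage_image_eq _ e.injective] using h'
  calc 𝔠 < 2 ^ 𝔠 := Cardinal.cantor _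
    _ = #(Set (Set ℕ)) := by simp
    _ ≤ #(Ultrafilter ℕ) := Cardinal.mk_le_of_injective hinj

end Ultrafilter

/-! ### Independence contradicts tameness. -/

section Independence

variable {T : Type w} {X : Type u} [Group T] [TopologicalSpace X] [CompactSpace X]
  [MulAction T X]

/-- An action with an infinite independence sequence for a pair of disjoint closed sets is not
tame. -/
theorem not_isTame_of_independent (t : ℕ → T) (C : Bool → Set X) (hC : ∀ b, IsClosed (C b))
    (hdisj : Disjoint (C true) (C false)) (h : ∀ a : ℕ → Bool, ∃ x, ∀ n, t n • x ∈ C (a n)) :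
    ¬ IsTame T X := by
  classical
  intro htame
  have hlim : ∀ p : Ultrafilter ℕ, ∃ f : ellisSemigroup T X,
      Tendsto (fun n (x : X) => t n • x) p (𝓝 f.1) := by
    intro p
    obtain ⟨f, -, hf⟩ := isCompact_univ.ultrafilter_le_nhds (p.map fun n (x : X) => t n • x)
      (by simp)
    exact ⟨⟨f, mem_closure_of_tendsto (b := (p : Filter ℕ)) hf
      (Eventually.of_forall fun n => ⟨t n, rfl⟩)⟩, hf⟩
  choose f hf using hlim
  have hinj : Function.Injective f := by
    intro p q hpq
    by_contra hne
    obtain ⟨A, hA⟩ : ∃ A, ¬ (A ∈ p ↔ A ∈ q) := by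
      by_contra! h
      exact hne (Ultrafilter.ext h)
    -- At this x the limit along an ultrafilter lies in `C true` or `C false` according to whether
    -- the ultrafilter contains A.
    obtain ⟨x, hx⟩ := h fun n => decide (n ∈ A)
    have hmem : ∀ r : Ultrafilter ℕ, A ∈ r → (f r).1 x ∈ C true := fun r hr =>
      (hC true).mem_of_tendsto (((continuous_apply x).tendsto _).comp (hf r))
        (by filter_upwards [hr] with n hn; simpa [hn] using hx n)
    have hnot : ∀ r : Ultrafilter ℕ, A ∉ r → (f r).1 x ∈ C false := fun r hr =>
      (hC false).mem_of_tendsto (((continuous_apply x).tendsto _).comp (hf r)) (by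
        filter_upwards [Ultrafilter.compl_mem_iff_notMem.2 hr] with n hn
        have hn' : n ∉ A := hn
        simpa [hn'] using hx n)
    by_cases hp : A ∈ p
    · have hq : A ∉ q := fun hq => hA (iff_of_true hp hq)
      exact Set.disjoint_left.1 hdisj (hmem p hp) (hpq ▸ hnot q hq)
    · have hq : A ∈ q := by
        by_contra hq
        exact hA (iff_of_false hp hq)
      exact Set.disjoint_left.1 hdisj (hmem q hq) (hpq ▸ hnot p hp)
  have h1 : Cardinal.lift.{u} #(Ultrafilter ℕ) ≤ Cardinal.lift.{0} #(ellisSemigroup T X) :=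
    Cardinal.lift_mk_le_lift_mk_of_injective hinj
  have h2 : Cardinal.lift.{u} 𝔠 < Cardinal.lift.{u} #(Ultrafilter ℕ) :=
    Cardinal.lift_lt.2 continuum_lt_mk_ultrafilter_nat
  rw [Cardinal.lift_continuum] at h2
  rw [Cardinal.lift_uzero] at h1
  exact absurd (h2.trans_le (h1.trans htame)) (lt_irrefl _)

end Independence

/-! ### Independence from a common boundary of positive measure. -/

section IndependenceSequence

variable {T : Type w} {H : Type v} {G : Type*} [Group T] [MulAction T H]
  [Group G] [MeasurableSpace G]
  [MetricSpace H] [CompactSpace H] [MeasurableSpace H] [BorelSpace H] [MulAction G H]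
  {m : Measure G} {μ : Measure H} [IsFiniteMeasure m] [IsFiniteMeasure μ]

open scoped ENNReal in
/-- If the set of group elements that move a finite family of points into a closed set has
positive measure, then this remains true for all nearby families. -/
theorem exists_pos_forall_measure_pos (hmeas : ∀ x : H, Measurable fun g : G => g • x)
    (hequi : UniformEquicontinuous fun (g : G) (x : H) => g • x)
    (hmap : ∀ x : H, m.map (fun g : G => g • x) = μ) {K : Set H} (hK : IsClosed K)
    {ι : Type} [Finite ι] (x : ι → H) (hx : 0 < m {g | ∀ i, g • x i ∈ K}) :
    ∃ δ > 0, ∀ y : ι → H, (∀ i, dist (y i) (x i) < δ) → 0 < m {g | ∀ i, g • y i ∈ K} := by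
  have := Fintype.ofFinite ι
  set c := m {g | ∀ i, g • x i ∈ K} with hc
  have hctop : c ≠ ∞ := measure_ne_top _ _
  have hN : ((Fintype.card ι : ℝ≥0∞) + 1) ≠ 0 := by simp
  have hN' : ((Fintype.card ι : ℝ≥0∞) + 1) ≠ ∞ := by finiteness
  -- Each index will lose measure at most ε, so the total loss stays below c.
  set ε := c / (Fintype.card ι + 1) with hε
  have hε0 : ε ≠ 0 := (ENNReal.div_pos hx.ne' hN').ne'
  have hεtop : ε ≠ ∞ := ENNReal.div_ne_top hctop hN
  have hεc : (Fintype.card ι : ℝ≥0∞) * ε < c := by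
    calc (Fintype.card ι : ℝ≥0∞) * ε < (Fintype.card ι : ℝ≥0∞) * ε + ε :=
          ENNReal.lt_add_right (by finiteness) hε0
      _ = (Fintype.card ι + 1) * ε := by ring
      _ = c := ENNReal.mul_div_cancel hN hN'
  obtain ⟨U, hKU, hU, hUε⟩ := K.exists_isOpen_lt_add (μ := μ) (measure_ne_top _ _) hε0
  have hUK : μ (U \ K) ≤ ε := by
    rw [measure_sdiff hKU hK.measurableSet.nullMeasurableSet (measure_ne_top _ _)]
    exact tsub_le_iff_left.2 hUε.le
  obtain ⟨r, hr, hrU⟩ := hK.isCompact.exists_thickening_subset_open hU hKU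
  obtain ⟨δ, hδ, hδr⟩ := Metric.uniformEquicontinuous_iff.1 hequi r hr
  refine ⟨δ, hδ, fun y hy => ?_⟩
  by_contra hzero
  have hzero' : m {g | ∀ i, g • y i ∈ K} = 0 := by simpa using hzero
  -- Uniform equicontinuity keeps g • y i within r of K, hence in U; it can miss K only inside U \
  -- K.
  have hsub : {g : G | ∀ i, g • x i ∈ K} ⊆
      {g | ∀ i, g • y i ∈ K} ∪ ⋃ i, (fun g : G => g • y i) ⁻¹' (U \ K) := by
    intro g hg
    by_cases h : ∀ i, g • y i ∈ K
    · exact Or.inl h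
    · push Not at h
      obtain ⟨i, hi⟩ := h
      refine Or.inr (Set.mem_iUnion.2 ⟨i, hrU ?_, hi⟩)
      exact Metric.mem_thickening_iff.2 ⟨g • x i, hg i, hδr _ _ (hy i) g⟩
  have hle : c ≤ Fintype.card ι * ε := by
    calc c ≤ m {g | ∀ i, g • y i ∈ K} + m (⋃ i, (fun g : G => g • y i) ⁻¹' (U \ K)) :=
          (measure_mono hsub).trans (measure_union_le _ _)
      _ ≤ 0 + ∑ i, m ((fun g : G => g • y i) ⁻¹' (U \ K)) :=
          add_le_add hzero'.le (measure_iUnion_fintype_le _ _)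
      _ = ∑ i : ι, μ (U \ K) := by
          rw [zero_add]
          refine Finset.sum_congr rfl fun i _ => ?_
          rw [← hmap (y i), Measure.map_apply (hmeas _) (hU.measurableSet.diff hK.measurableSet)]
      _ ≤ ∑ i : ι, ε := Finset.sum_le_sum fun _ _ => hUK
      _ = Fintype.card ι * ε := by simp
  exact absurd hεc hle.not_gt

/-- There is a finite family of points which realizes all the patterns of the first `n` members
of the sequence `t`, and which is moved into `K` by a set of group elements of positive measure. -/
def HasPatternFamily (m : Measure G) (K : Set H) (O : Bool → Set H) (n : ℕ) (t : ℕ → T) : Prop :=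
  ∃ (ι : Type) (_ : Finite ι) (x : ι → H), 0 < m {g | ∀ i, g • x i ∈ K} ∧
    ∀ a : ℕ → Bool, ∃ i, ∀ j < n, t j • x i ∈ O (a j)

variable [ContinuousConstSMul T H] [ContinuousConstSMul G H]

/-- Fix g moving every x i into K. As K lies in the closure of both `O b`, each x i splits into two
nearby points that g sends into `O true` and `O false`. Closeness keeps the old patterns and the
positive measure. -/
theorem HasPatternFamily.exists_succ (hmeas : ∀ x : H, Measurable fun g : G => g • x)
    (hequi : UniformEquicontinuous fun (g : G) (x : H) => g • x)
    (hmap : ∀ x : H, m.map (fun g : G => g • x) = μ)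
    (hG : ∀ g : G, (fun x : H => g • x) ∈ ellisSemigroup T H)
    {K : Set H} (hK : IsClosed K) {O : Bool → Set H} (hO : ∀ b, IsOpen (O b))
    (hKO : ∀ b, K ⊆ closure (O b)) {n : ℕ} {t : ℕ → T} (h : HasPatternFamily m K O n t) :
    ∃ s, HasPatternFamily m K O (n + 1) (Function.update t n s) := by
  obtain ⟨ι, hι, x, hpos, hx⟩ := h
  have hpos' : 0 < m {g : G | ∀ p : ι × Bool, g • x p.1 ∈ K} := by
    simpa [Prod.forall] using hpos
  obtain ⟨δ, hδ, hstable⟩ := exists_pos_forall_measure_pos hmeas hequi hmap hK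
    (fun p : ι × Bool => x p.1) hpos'
  obtain ⟨g, hg⟩ : ∃ g : G, ∀ i, g • x i ∈ K := nonempty_of_measure_ne_zero hpos.ne'
  have hnear : ∀ p : ι × Bool, ∃ y, dist y (x p.1) < δ ∧ g • y ∈ O p.2 ∧
      ∀ j < n, ∀ b, t j • x p.1 ∈ O b → t j • y ∈ O b := by
    rintro ⟨i, b⟩
    have hev : ∀ᶠ y in 𝓝 (x i), dist y (x i) < δ ∧
        ∀ j < n, ∀ b, t j • x i ∈ O b → t j • y ∈ O b := by
      refine Eventually.and (Metric.ball_mem_nhds _ hδ) ?_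
      refine (eventually_all_finite (Set.finite_lt_nat n)).2 fun j _ => eventually_all.2 fun b => ?_
      by_cases hb : t j • x i ∈ O b
      · filter_upwards [(continuous_const_smul (t j)).continuousAt.eventually_mem
          ((hO b).mem_nhds hb)] with y hy _ using hy
      · exact Eventually.of_forall fun y hy => absurd hy hb
    have hev' : ∀ᶠ z in 𝓝 (g • x i), dist (g⁻¹ • z) (x i) < δ ∧
        ∀ j < n, ∀ b, t j • x i ∈ O b → t j • g⁻¹ • z ∈ O b := by
      have hc := (continuous_const_smul (T := H) g⁻¹).tendsto (g • x i)
      rw [inv_smul_smul] at hc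
      exact hc.eventually hev
    obtain ⟨z, hzO, hz⟩ := mem_closure_iff_frequently.1 (hKO b (hg i)) |>.and_eventually hev'
      |>.exists
    exact ⟨g⁻¹ • z, hz.1, by simpa using hzO, hz.2⟩
  choose y hyδ hyO hyt using hnear
  have hopen : IsOpen {f : H → H | ∀ p : ι × Bool, f (y p) ∈ O p.2} := by
    simp only [Set.ofPred_forall]
    exact isOpen_iInter_of_finite fun p => (hO p.2).preimage (continuous_apply (y p))
  -- g is a pointwise limit of T and only finitely many open conditions matter, so some s in T
  -- replaces it.
  obtain ⟨_, hs, s, rfl⟩ := mem_closure_iff.1 (hG g) _ hopen hyO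
  refine ⟨s, ι × Bool, inferInstance, y, hstable y hyδ, fun a => ?_⟩
  obtain ⟨i, hi⟩ := hx a
  refine ⟨(i, a n), fun j hj => ?_⟩
  rcases Nat.lt_succ_iff_lt_or_eq.1 hj with hj | rfl
  · rw [Function.update_of_ne hj.ne]
    exact hyt _ j hj _ (hi j hj)
  · rw [Function.update_self]
    exact hs (i, a j)

/-- A closed set of positive measure in the common boundary of two open sets yields an infinite
independence sequence. -/
theorem exists_independence_sequence (hmeas : ∀ x : H, Measurable fun g : G => g • x)
    (hequi : UniformEquicontinuous fun (g : G) (x : H) => g • x)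
    (hmap : ∀ x : H, m.map (fun g : G => g • x) = μ)
    (hG : ∀ g : G, (fun x : H => g • x) ∈ ellisSemigroup T H)
    {K : Set H} (hK : IsClosed K) (hμK : 0 < μ K) {O : Bool → Set H} (hO : ∀ b, IsOpen (O b))
    (hKO : ∀ b, K ⊆ closure (O b)) :
    ∃ t : ℕ → T, ∀ (a : ℕ → Bool) (n : ℕ), ∃ x, ∀ j < n, t j • x ∈ O (a j) := by
  obtain ⟨x₀, -⟩ : K.Nonempty := nonempty_of_measure_ne_zero hμK.ne'
  have hzero : HasPatternFamily m K O 0 (fun _ => (1 : T)) := by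
    refine ⟨Unit, inferInstance, fun _ => x₀, ?_, fun _ => ⟨(), by simp⟩⟩
    rw [← hmap x₀, Measure.map_apply (hmeas x₀) hK.measurableSet] at hμK
    exact hμK.trans_le (measure_mono fun g hg _ => hg)
  have hstep := fun n (t : {t : ℕ → T // HasPatternFamily m K O n t}) =>
    t.2.exists_succ hmeas hequi hmap hG hK hO hKO
  choose s hs using hstep
  let σ : ∀ n, {t : ℕ → T // HasPatternFamily m K O n t} := fun n =>
    Nat.rec ⟨_, hzero⟩ (fun n t => ⟨_, hs n t⟩) n
  have hsucc : ∀ n, (σ (n + 1)).1 = Function.update (σ n).1 n (s n (σ n)) := fun n => rfl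
  -- Passing from stage n to n + 1 changes only entry n, so entry j is final from stage j + 1 on.
  have hconst : ∀ j k, (σ (j + 1 + k)).1 j = (σ (j + 1)).1 j := by
    intro j k
    induction k with
    | zero => rfl
    | succ k ih => rw [← add_assoc, hsucc, Function.update_of_ne (by omega), ih]
  refine ⟨fun j => (σ (j + 1)).1 j, fun a n => ?_⟩
  obtain ⟨ι, -, x, -, hx⟩ := (σ n).2
  obtain ⟨i, hi⟩ := hx a
  refine ⟨x i, fun j hj => ?_⟩
  obtain ⟨k, rfl⟩ := Nat.exists_eq_add_of_lt hj
  have h := hi j hj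
  rwa [show j + k + 1 = j + 1 + k by omega, hconst] at h

end IndependenceSequence

/-! ### Topology of the injectivity points. -/

section InjectivityPoints

variable {X : Type u} {H : Type v} {β : X → H}

theorem mem_image_injectivityPoints_iff {h : H} :
    h ∈ β '' injectivityPoints β ↔ ∃ x, β ⁻¹' {h} = {x} := by
  constructor
  · rintro ⟨x, hx, rfl⟩
    exact ⟨x, hx⟩
  · rintro ⟨x, hx⟩
    have hxh : β x = h := hx.ge rfl
    exact ⟨x, by rw [injectivityPoints, Set.mem_ofPred_eq, hxh, hx], hxh⟩

variable [MetricSpace X]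

/-- Injectivity points in V are dense in its closure, and the fibre through each is a single point
of V. -/
theorem IsAlmostOneToOne.image_closure_subset [MetricSpace H] (hβ : IsAlmostOneToOne β) {V : Set X}
    (hV : IsOpen V) : β '' closure V ⊆ closure {h | β ⁻¹' {h} ⊆ V} := by
  have hV' : closure V ⊆ closure (V ∩ injectivityPoints β) :=
    closure_minimal (hβ.2.open_subset_closure_inter hV) isClosed_closure
  refine (Set.image_mono hV').trans ((image_closure_subset_closure_image hβ.1).trans
    (closure_mono ?_))
  rintro _ ⟨x, ⟨hxV, hx⟩, rfl⟩
  have hx' : β ⁻¹' {β x} = {x} := hx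
  simpa [hx'] using hxV

variable [CompactSpace X]

/-- The complement of the image of the injectivity points is a countable union of intersections of
images of pairs of closed sets. -/
theorem compl_image_injectivityPoints (hβ : Function.Surjective β) :
    (β '' injectivityPoints β)ᶜ = ⋃ p ∈ {p ∈ TopologicalSpace.countableBasis X ×ˢ
      TopologicalSpace.countableBasis X | Disjoint (closure p.1) (closure p.2)},
        β '' closure p.1 ∩ β '' closure p.2 := by
  ext h
  simp only [Set.mem_compl_iff, mem_image_injectivityPoints_iff, Set.mem_iUnion, exists_prop]
  constructor
  · intro hh
    obtain ⟨x, rfl⟩ := hβ h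
    obtain ⟨y, hy, hne⟩ : ∃ y, β y = β x ∧ y ≠ x := by
      by_contra! hcon
      exact hh ⟨x, Set.eq_singleton_iff_unique_mem.2 ⟨rfl, hcon⟩⟩
    obtain ⟨U, hxU, hU, V, hyV, hV, hUV⟩ := exists_open_nhds_disjoint_closure hne.symm
    have hB := TopologicalSpace.isBasis_countableBasis X
    obtain ⟨U', hU', hxU', hUU'⟩ := hB.exists_subset_of_mem_open hxU hU
    obtain ⟨V', hV', hyV', hVV'⟩ := hB.exists_subset_of_mem_open hyV hV
    exact ⟨(U', V'), ⟨⟨hU', hV'⟩, hUV.mono (closure_mono hUU') (closure_mono hVV')⟩,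
      ⟨x, subset_closure hxU', rfl⟩, ⟨y, subset_closure hyV', hy⟩⟩
  · rintro ⟨p, ⟨-, hp⟩, ⟨x, hx, hxh⟩, ⟨y, hy, hyh⟩⟩ ⟨z, hz⟩
    have hxz : x = z := hz.le hxh
    have hyz : y = z := hz.le hyh
    exact Set.disjoint_left.1 hp hx (hxz.trans hyz.symm ▸ hy)

theorem countable_disjoint_closure_countableBasis :
    {p ∈ TopologicalSpace.countableBasis X ×ˢ TopologicalSpace.countableBasis X |
      Disjoint (closure p.1) (closure p.2)}.Countable :=
  ((TopologicalSpace.countable_countableBasis X).prod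
    (TopologicalSpace.countable_countableBasis X)).mono (Set.sep_subset _ _)

variable [MetricSpace H]

theorem isClosed_image_closure (hβ : Continuous β) (s : Set X) : IsClosed (β '' closure s) :=
  (isClosed_closure.isCompact.image hβ).isClosed

theorem measurableSet_image_injectivityPoints [MeasurableSpace H] [BorelSpace H]
    (hβ : Continuous β) (hsurj : Function.Surjective β) :
    MeasurableSet (β '' injectivityPoints β) := by
  rw [← MeasurableSet.compl_iff, compl_image_injectivityPoints hsurj]
  exact MeasurableSet.biUnion countable_disjoint_closure_countableBasis fun p _ =>
    ((isClosed_image_closure hβ _).inter (isClosed_image_closure hβ _)).measurableSet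

theorem isOpen_setOf_preimage_singleton_subset (hβ : Continuous β) {V : Set X} (hV : IsOpen V) :
    IsOpen {h | β ⁻¹' {h} ⊆ V} := by
  have h : {h | β ⁻¹' {h} ⊆ V} = (β '' Vᶜ)ᶜ := by
    ext h
    constructor
    · rintro hh ⟨x, hx, rfl⟩
      exact hx (hh rfl)
    · intro hh x hx
      by_contra hxV
      exact hh ⟨x, hxV, hx⟩
  rw [h]
  exact (hV.isClosed_compl.isCompact.image hβ).isClosed.isOpen_compl

end InjectivityPoints

/-! ### Null intersections and the conclusion. -/

section Tame

variable {T : Type w} {X : Type u} {H : Type v} {G : Type*} [Group T]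
  [MetricSpace X] [CompactSpace X] [MulAction T X] [ContinuousConstSMul T X]
  [MetricSpace H] [CompactSpace H] [MeasurableSpace H] [BorelSpace H] [MulAction T H]
  [ContinuousConstSMul T H] [Group G] [MeasurableSpace G] [MulAction G H] [ContinuousConstSMul G H]
  {m : Measure G} {μ : Measure H} [IsFiniteMeasure m] [IsFiniteMeasure μ] {β : X → H}

/-- For a tame almost one-to-one extension, the images of disjoint closures of open sets meet in
a null set. -/
theorem measure_image_closure_inter_eq_zero (hfac : IsFactorMap T β) (hβ : IsAlmostOneToOne β)
    (htame : IsTame T X) (hmeas : ∀ x : H, Measurable fun g : G => g • x)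
    (hequi : UniformEquicontinuous fun (g : G) (x : H) => g • x)
    (hmap : ∀ x : H, m.map (fun g : G => g • x) = μ)
    (hG : ∀ g : G, (fun x : H => g • x) ∈ ellisSemigroup T H)
    {U V : Set X} (hU : IsOpen U) (hV : IsOpen V) (hUV : Disjoint (closure U) (closure V)) :
    μ (β '' closure U ∩ β '' closure V) = 0 := by
  by_contra hne
  let W : Bool → Set X := fun b => bif b then U else V
  have hW : ∀ b, IsOpen (W b) := by
    rintro (_ | _)
    exacts [hV, hU]
  have hK : ∀ b, β '' closure U ∩ β '' closure V ⊆ closure {h | β ⁻¹' {h} ⊆ W b} := by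
    rintro (_ | _)
    exacts [Set.inter_subset_right.trans (hβ.image_closure_subset hV),
      Set.inter_subset_left.trans (hβ.image_closure_subset hU)]
  obtain ⟨t, ht⟩ := exists_independence_sequence (T := T) hmeas hequi hmap hG
    ((isClosed_image_closure hβ.1 U).inter (isClosed_image_closure hβ.1 V))
    (pos_iff_ne_zero.2 hne) (fun b => isOpen_setOf_preimage_singleton_subset hβ.1 (hW b)) hK
  refine not_isTame_of_independent t (fun b => closure (W b)) (fun _ => isClosed_closure) hUV
    (fun a => ?_) htame
  -- The first n entries of a are realized in H and lift to X; the nested compact sets `Z n` yield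
  -- one point for all of a.
  let Z : ℕ → Set X := fun n => ⋂ j ∈ Set.Iio n, (fun x => t j • x) ⁻¹' closure (W (a j))
  have hZ : ∀ n, IsClosed (Z n) := fun n => isClosed_biInter fun j _ =>
    isClosed_closure.preimage (continuous_const_smul (t j))
  obtain ⟨x, hx⟩ : (⋂ n, Z n).Nonempty := by
    refine IsCompact.nonempty_iInter_of_sequence_nonempty_isCompact_isClosed Z
      (fun n => Set.biInter_subset_biInter_left (Set.Iio_subset_Iio n.le_succ)) (fun n => ?_)
      (hZ 0).isCompact hZ
    obtain ⟨h, hh⟩ := ht a n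
    obtain ⟨x, rfl⟩ := hfac.surjective h
    exact ⟨x, Set.mem_iInter₂.2 fun j hj => subset_closure (hh j hj (hfac.map_smul (t j) x))⟩
  exact ⟨x, fun n => Set.mem_iInter₂.1 (Set.mem_iInter.1 hx (n + 1)) n n.lt_succ_self⟩

end Tame

theorem theorem1p2 {T : Type w} {X : Type u} {H : Type v}
    [Group T] [TopologicalSpace T] [IsTopologicalGroup T]
    [MetricSpace X] [CompactSpace X] [Nonempty X] [MulAction T X] [ContinuousSMul T X]
    [MetricSpace H] [CompactSpace H] [MulAction T H] [ContinuousSMul T H]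
    [MeasurableSpace H] [BorelSpace H]
    (β : X → H) (hβ : IsAlmostAutomorphic T β) (htame : IsTame T X) :
    IsRegularExtension T β ∧
      ∃ μ : Measure H, IsUniqueInvariantProbability T μ ∧
        MeasurableSet (β '' injectivityPoints β) ∧ μ (β '' injectivityPoints β) = 1 := by
  suffices hμ : ∃ μ : Measure H, IsUniqueInvariantProbability T μ ∧
      MeasurableSet (β '' injectivityPoints β) ∧ μ (β '' injectivityPoints β) = 1 by
    obtain ⟨μ, hμ, hm, h1⟩ := hμ
    exact ⟨⟨μ, hμ, h1 ▸ one_pos⟩, μ, hμ, hm, h1⟩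
  have hT := hβ.isMEF.equicontinuous
  have := hβ.isMinimal
  have := hT.continuousSMul_ellisSemigroup
  have := hT.continuousMul_ellisSemigroup
  have := hT.compactSpace_units_ellisSemigroup
  let G := (ellisSemigroup T H)ˣ
  let : MeasurableSpace G := borel G
  have : BorelSpace G := ⟨rfl⟩
  have hG : ∀ g : G, (fun x : H => g • x) ∈ ellisSemigroup T H := fun g => g.1.2
  have hTG : ∀ t : T, ∃ g : G, ∀ x : H, g • x = t • x := fun t =>
    ⟨(toEllisSemigroup T H).toHomUnits t, fun _ => rfl⟩
  have hmeas : ∀ x : H, Measurable fun g : G => g • x := fun x =>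
    (continuous_id.smul continuous_const).measurable
  have hequi : UniformEquicontinuous fun (g : G) (x : H) => g • x :=
    CompactSpace.uniformEquicontinuous_of_equicontinuous
      (hT.equicontinuous_ellisSemigroup.comp fun g : G => g.1)
  have huniq := isUniqueInvariantProbability_map_haarMeasure (G := G) hG hTG hT
    hT.exists_units_smul_eq
  have := isProbabilityMeasure_haarMeasure_top (G := G)
  obtain ⟨x⟩ := ‹Nonempty X›
  have hprob := (huniq (β x)).1.isProbabilityMeasure
  have hfac := hβ.isFactorMap
  have hm := measurableSet_image_injectivityPoints hfac.continuous hfac.surjective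
  refine ⟨_, huniq (β x), hm, (prob_compl_eq_zero_iff hm).1 ?_⟩
  rw [compl_image_injectivityPoints hfac.surjective]
  refine (measure_biUnion_null_iff countable_disjoint_closure_countableBasis).2 fun p hp => ?_
  have hB := TopologicalSpace.isBasis_countableBasis X
  -- By uniqueness, the orbit maps of all base points push Haar measure to the same μ.
  exact measure_image_closure_inter_eq_zero hfac hβ.isAlmostOneToOne htame hmeas hequi
    (fun y => (huniq (β x)).2 _ (huniq y).1) hG (hB.isOpen hp.1.1) (hB.isOpen hp.1.2) hp.2
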